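/- Let $l,\alpha,k>0$. For $u\in C^3[-l,l]$ (complex-valued) put $\mathcal B[u]=(u(-l),u'(-l),u''(-l),u'''(-l),u(l),u'(l),u''(l),u'''(l))^T$. A complex $4\times 8$ matrix $\mathbf M$ is called well-posed if $u=0$ is the only solution on $[-l,l]$ of $u''''+\alpha^4u=0$ with $\mathbf M\,\mathcal B[u]=\mathbf 0$; $\mathrm{wp}(4,8,\mathbb R)$ is the set of well-posed matrices with real entries. For well-posed $\mathbf M=(\mathbf M^-\ \mathbf M^+)$, with $4\times4$ blocks $\mathbf M^\pm$, let $\mathcal K_{\mathbf M}$ be the integral operator $\mathcal K_{\mathbf M}[w](x)=\int_{-l}^{l}G_{\mathbf M}(x,\xi)w(\xi)\,d\xi$ on the complex Hilbert space $L^2[-l,l]$, where $G_{\mathbf M}$ is the Green's function of the problem $u''''+\alpha^4u=\frac{\alpha^4}{k}w$, $\mathbf M\,\mathcal B[u]=\mathbf 0$. Explicitly, let $\omega_j=e^{i\pi(2j-1)/4}$, $\mathbf y(x)=(e^{\omega_1\alpha x},\dots,e^{\omega_4\alpha x})^T$, $\mathbf W(x)=\big((\omega_j\alpha)^{i-1}e^{\omega_j\alpha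 x}\big)_{1\le i,j\le4}$, $\mathbf\Omega=\mathrm{diag}(\omega_1,\dots,\omega_4)$, let $\mathbf P$ be the permutation matrix with $\mathbf P(c_1,c_2,c_3,c_4)^T=(c_3,c_4,c_1,c_2)^T$, and let $\widetilde{\mathbf M}=\mathbf M^-\mathbf W(-l)+\mathbf M^+\mathbf W(l)$, which is invertible. Then $$G_{\mathbf M}(x,\xi)=\frac{\alpha}{4k}\,\mathbf y(x)^T\,\widetilde{\mathbf M}^{-1}\mathbf M^+\mathbf W(l)\,\mathbf\Omega\mathbf P\,\mathbf y(\xi)\quad(x\le\xi),$$ $$G_{\mathbf M}(x,\xi)=-\frac{\alpha}{4k}\,\mathbf y(x)^T\,\widetilde{\mathbf M}^{-1}\mathbf M^-\mathbf W(-l)\,\mathbf\Omega\mathbf P\,\mathbf y(\xi)\quad(\xi\le x).$$ Write $\mathrm{Spec}\,\mathcal K$ for the set of eigenvalues of $\mathcal K$, and let $$\mathbf Q=\begin{pmatrix}0&\alpha^2&-\sqrt2\alpha&1&0&0&0&0\\ \sqrt2\alpha^3&-\alpha^2&0&1&0&0&0&0\\ 0&0&0&0&0&\alpha^2&\sqrt2\alpha&1\\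 0&0&0&0&-\sqrt2\alpha^3&-\alpha^2&0&1\end{pmatrix}.$$ Then $\mathbf Q\in\mathrm{wp}(4,8,\mathbb R)$, and $\mathcal K_{\mathbf Q}$ is the operator $\mathcal K_{l,\alpha,k}$ on $L^2[-l,l]$ with kernel $\frac{\alpha}{2k}\exp\!\left(-\frac{\alpha}{\sqrt2}|x-\xi|\right)\sin\!\left(\frac{\alpha}{\sqrt2}|x-\xi|+\frac\pi4\right)$. For every real $\lambda\neq0$ with $\lambda\notin\mathrm{Spec}\,\mathcal K_{\mathbf Q}$ there exists $\mathbf M\in\mathrm{wp}(4,8,\mathbb R)$ such that $\lambda\in\mathrm{Spec}\,\mathcal K_{\mathbf M}$. Consequently $\mathcal K_{\mathbf M}$ need be neither positive (all $k\mu$, $\mu\in\mathrm{Spec}\,\mathcal K_{\mathbf M}$, are positive) nor contractive ($k\,\|\mathcal K_{\mathbf M}\|_{L^2\to L^2}<1$), even for real $\mathbf M$: there is $\mathbf M\in\mathrm{wp}(4,8,\mathbb R)$ for which $\mathcal K_{\mathbf M}$ has neither property. -/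

import Mathlib

namespace Beam

open MeasureTheory Set

/-- The Hilbert space `L²[-l, l]` of complex-valued square-integrable functions on `[-l, l]`. -/
abbrev L2 (l : ℝ) : Type :=
  Lp ℂ 2 ((volume : Measure ℝ).restrict (Icc (-l) l))

/-! ### Integral operators with bounded measurable kernels -/

theorem integrable_kernel_mul {l : ℝ} {g : ℝ → ℝ → ℂ} (hm : Measurable (Function.uncurry g))
    {C : ℝ} (hC : ∀ x ∈ Icc (-l) l, ∀ ξ ∈ Icc (-l) l, ‖g x ξ‖ ≤ C) (w : L2 l)
    {x : ℝ} (hx : x ∈ Icc (-l) l) :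
    Integrable (fun ξ => g x ξ * w ξ) ((volume : Measure ℝ).restrict (Icc (-l) l)) := by
  have hw : Integrable w ((volume : Measure ℝ).restrict (Icc (-l) l)) :=
    (Lp.memLp w).integrable (by norm_num)
  refine hw.bdd_mul (c := C) ?_ ?_
  · exact (hm.comp (measurable_const.prodMk measurable_id)).aestronglyMeasurable
  · filter_upwards [ae_restrict_mem measurableSet_Icc] with ξ hξ using hC x hx ξ hξ

theorem norm_integral_kernel_le {l : ℝ} {g : ℝ → ℝ → ℂ} {C : ℝ}
    (hC : ∀ x ∈ Icc (-l) l, ∀ ξ ∈ Icc (-l) l, ‖g x ξ‖ ≤ C) (w : L2 l)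
    {x : ℝ} (hx : x ∈ Icc (-l) l) :
    ‖∫ ξ in Icc (-l) l, g x ξ * w ξ‖ ≤ C * ∫ ξ in Icc (-l) l, ‖w ξ‖ := by
  have hw : Integrable w ((volume : Measure ℝ).restrict (Icc (-l) l)) :=
    (Lp.memLp w).integrable (by norm_num)
  rw [← integral_const_mul]
  refine norm_integral_le_of_norm_le (hw.norm.const_mul C) ?_
  filter_upwards [ae_restrict_mem measurableSet_Icc] with ξ hξ
  rw [norm_mul]
  exact mul_le_mul_of_nonneg_right (hC x hx ξ hξ) (norm_nonneg _)

theorem memLp_integral_kernel {l : ℝ} {g : ℝ → ℝ → ℂ} (hm : Measurable (Function.uncurry g))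
    (hb : ∃ C : ℝ, ∀ x ∈ Icc (-l) l, ∀ ξ ∈ Icc (-l) l, ‖g x ξ‖ ≤ C) (w : L2 l) :
    MemLp (fun x => ∫ ξ in Icc (-l) l, g x ξ * w ξ) 2
      ((volume : Measure ℝ).restrict (Icc (-l) l)) := by
  obtain ⟨C, hC⟩ := hb
  refine MemLp.of_bound (C := C * ∫ ξ in Icc (-l) l, ‖w ξ‖) ?_ ?_
  · refine StronglyMeasurable.aestronglyMeasurable ?_
    refine StronglyMeasurable.integral_prod_right (f := fun x ξ => g x ξ * w ξ) ?_
    exact hm.stronglyMeasurable.mul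
      ((Lp.stronglyMeasurable w).comp_measurable measurable_snd)
  · filter_upwards [ae_restrict_mem measurableSet_Icc] with x hx
    exact norm_integral_kernel_le hC w hx

/-- The linear map `w ↦ ∫_{-l}^{l} g(·, ξ) w(ξ) dξ` on `L²[-l, l]`. -/
noncomputable def kernelLinearMap (l : ℝ) (g : ℝ → ℝ → ℂ)
    (hm : Measurable (Function.uncurry g))
    (hb : ∃ C : ℝ, ∀ x ∈ Icc (-l) l, ∀ ξ ∈ Icc (-l) l, ‖g x ξ‖ ≤ C) : L2 l →ₗ[ℂ] L2 l where
  toFun w := (memLp_integral_kernel hm hb w).toLp _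
  map_add' w₁ w₂ := by
    rw [← MemLp.toLp_add]
    refine MemLp.toLp_congr _ _ ?_
    obtain ⟨C, hC⟩ := hb
    filter_upwards [ae_restrict_mem measurableSet_Icc] with x hx
    rw [Pi.add_apply, ← integral_add (integrable_kernel_mul hm hC w₁ hx)
      (integrable_kernel_mul hm hC w₂ hx)]
    refine integral_congr_ae ?_
    filter_upwards [Lp.coeFn_add w₁ w₂] with ξ hξ
    rw [hξ, Pi.add_apply, mul_add]
  map_smul' c w := by
    rw [RingHom.id_apply, ← MemLp.toLp_const_smul]
    refine MemLp.toLp_congr _ _ ?_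
    refine Filter.Eventually.of_forall fun x => ?_
    simp only [Pi.smul_apply]
    rw [← integral_smul]
    refine integral_congr_ae ?_
    filter_upwards [Lp.coeFn_smul c w] with ξ hξ
    rw [hξ, Pi.smul_apply, smul_eq_mul, smul_eq_mul, mul_left_comm]

theorem kernelLinearMap_bound (l : ℝ) (g : ℝ → ℝ → ℂ)
    (hm : Measurable (Function.uncurry g))
    (hb : ∃ C : ℝ, ∀ x ∈ Icc (-l) l, ∀ ξ ∈ Icc (-l) l, ‖g x ξ‖ ≤ C) :
    ∃ D : ℝ, ∀ w : L2 l, ‖kernelLinearMap l g hm hb w‖ ≤ D * ‖w‖ := by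
  obtain ⟨C, hC⟩ := id hb
  set μ : Measure ℝ := (volume : Measure ℝ).restrict (Icc (-l) l) with hμ
  set m : ℝ := (μ univ).toReal ^ (1 / 2 : ℝ) with hmdef
  have hl1 : ∀ w : L2 l, ∫ ξ, ‖w ξ‖ ∂μ ≤ m * ‖w‖ := by
    intro w
    have h1 : eLpNorm w 1 μ ≤ eLpNorm w 2 μ * μ univ ^ (1 / 2 : ℝ) := by
      have h := eLpNorm_le_eLpNorm_mul_rpow_measure_univ (p := 1) (q := 2) (by norm_num)
        (Lp.aestronglyMeasurable w)
      have e : 1 / ENNReal.toReal 1 - 1 / ENNReal.toReal 2 = (1 / 2 : ℝ) := by norm_num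
      rwa [e] at h
    have h2 : ∫ ξ, ‖w ξ‖ ∂μ = (eLpNorm w 1 μ).toReal := by
      rw [eLpNorm_one_eq_lintegral_enorm, integral_norm_eq_lintegral_enorm
        (Lp.aestronglyMeasurable w)]
    rw [h2, Lp.norm_def, hmdef, mul_comm, ENNReal.toReal_rpow, ← ENNReal.toReal_mul]
    refine ENNReal.toReal_mono ?_ h1
    exact ENNReal.mul_ne_top (Lp.eLpNorm_ne_top w)
      (ENNReal.rpow_ne_top_of_nonneg (by norm_num) (measure_ne_top μ univ))
  refine ⟨m * (|C| * m), fun w => ?_⟩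
  have hm0 : 0 ≤ m := Real.rpow_nonneg ENNReal.toReal_nonneg _
  have hle : ∀ᵐ x ∂μ, ‖kernelLinearMap l g hm hb w x‖ ≤ |C| * (m * ‖w‖) := by
    filter_upwards [ae_restrict_mem measurableSet_Icc,
      (memLp_integral_kernel hm hb w).coeFn_toLp] with x hx hx'
    have e : kernelLinearMap l g hm hb w x = ∫ ξ in Icc (-l) l, g x ξ * w ξ := hx'
    rw [e]
    refine (norm_integral_kernel_le hC w hx).trans ?_
    refine (mul_le_mul_of_nonneg_right (le_abs_self C)
      (integral_nonneg fun _ => norm_nonneg _)).trans ?_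
    exact mul_le_mul_of_nonneg_left (hl1 w) (abs_nonneg C)
  have hfin := Lp.norm_le_of_ae_bound (p := 2) (by positivity) hle
  refine hfin.trans (le_of_eq ?_)
  have : ((measureUnivNNReal μ : ℝ) ^ (ENNReal.toReal 2)⁻¹) = m := by
    rw [hmdef]
    norm_num [measureUnivNNReal]
    rfl
  rw [this]
  ring

/-- The bounded operator `w ↦ ∫_{-l}^{l} g(·, ξ) w(ξ) dξ` on `L²[-l, l]`, for a measurable kernel
`g` that is bounded on `[-l, l] × [-l, l]`. -/
noncomputable def kernelOperator (l : ℝ) (g : ℝ → ℝ → ℂ)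
    (hm : Measurable (Function.uncurry g))
    (hb : ∃ C : ℝ, ∀ x ∈ Icc (-l) l, ∀ ξ ∈ Icc (-l) l, ‖g x ξ‖ ≤ C) : L2 l →L[ℂ] L2 l :=
  (kernelLinearMap l g hm hb).mkContinuousOfExistsBound (kernelLinearMap_bound l g hm hb)

theorem kernelOperator_ae_eq (l : ℝ) (g : ℝ → ℝ → ℂ)
    (hm : Measurable (Function.uncurry g))
    (hb : ∃ C : ℝ, ∀ x ∈ Icc (-l) l, ∀ ξ ∈ Icc (-l) l, ‖g x ξ‖ ≤ C) (w : L2 l) :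
    kernelOperator l g hm hb w =ᵐ[(volume : Measure ℝ).restrict (Icc (-l) l)]
      fun x => ∫ ξ in Icc (-l) l, g x ξ * w ξ :=
  (memLp_integral_kernel hm hb w).coeFn_toLp

/-- The spectrum in the sense of the set of eigenvalues. -/
def Spec {l : ℝ} (K : L2 l →L[ℂ] L2 l) : Set ℂ :=
  {μ | Module.End.HasEigenvalue (K : L2 l →ₗ[ℂ] L2 l) μ}

/-! ### Boundary conditions and well-posedness -/

/-- The boundary data
`(u(-l), u'(-l), u''(-l), u'''(-l), u(l), u'(l), u''(l), u'''(l))`,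
with the (one-sided, at the end points) derivatives of `u` on `[-l, l]`. -/
noncomputable def boundaryData (l : ℝ) (u : ℝ → ℂ) : Fin 8 → ℂ :=
  Fin.append (m := 4) (n := 4)
    (fun i => iteratedDerivWithin i u (Icc (-l) l) (-l))
    (fun i => iteratedDerivWithin i u (Icc (-l) l) l)

/-- `M` is well-posed: the only solution on `[-l, l]` of `u'''' + α⁴ u = 0` that satisfies the
homogeneous boundary condition `M · B[u] = 0` is `u = 0`. -/
def IsWellPosed (l α : ℝ) (M : Matrix (Fin 4) (Fin 8) ℂ) : Prop :=
  ∀ u : ℝ → ℂ, ContDiffOn ℝ 4 u (Icc (-l) l) →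
    (∀ x ∈ Icc (-l) l, iteratedDerivWithin 4 u (Icc (-l) l) x + (α : ℂ) ^ 4 * u x = 0) →
    M.mulVec (boundaryData l u) = 0 →
    ∀ x ∈ Icc (-l) l, u x = 0

/-- The set `wp(4, 8, ℂ)` of well-posed matrices. -/
def wpC (l α : ℝ) : Set (Matrix (Fin 4) (Fin 8) ℂ) :=
  {M | IsWellPosed l α M}

/-- The set `wp(4, 8, ℝ)` of well-posed matrices with real entries. -/
def wpR (l α : ℝ) : Set (Matrix (Fin 4) (Fin 8) ℂ) :=
  {M | M ∈ wpC l α ∧ ∀ i j, (M i j).im = 0}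

/-! ### The Green's function and the integral operator of a boundary condition -/

/-- `ω₁, ω₂, ω₃, ω₄`, the fourth roots of `-1`, where `ω_j = exp(i π (2 j - 1) / 4)`;
the index is shifted by one. -/
noncomputable def omega (j : Fin 4) : ℂ :=
  Complex.exp (Complex.I * ((Real.pi / 4 * (2 * ((j : ℕ) : ℝ) + 1) : ℝ) : ℂ))

/-- `Ω = diag(ω₁, ω₂, ω₃, ω₄)`. -/
noncomputable def Omega : Matrix (Fin 4) (Fin 4) ℂ :=
  Matrix.diagonal omega

/-- The cyclic shift matrix `L`. -/
def shiftL : Matrix (Fin 4) (Fin 4) ℂ :=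
  !![0, 1, 0, 0;
     0, 0, 1, 0;
     0, 0, 0, 1;
     1, 0, 0, 0]

/-- The fundamental solutions `y_j(x) = exp(ω_j α x)` of `u'''' + α⁴ u = 0`. -/
noncomputable def y (α x : ℝ) (j : Fin 4) : ℂ :=
  Complex.exp (omega j * α * x)

/-- The Wronskian matrix of `y₁, y₂, y₃, y₄`, with rows `y, y', y'', y'''`. -/
noncomputable def W (α x : ℝ) : Matrix (Fin 4) (Fin 4) ℂ :=
  Matrix.of fun i j => (omega j * α) ^ (i : ℕ) * y α x j

/-- `M⁻ W(-l)`, where `M = (M⁻ M⁺)` in `4 × 4` blocks. -/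
noncomputable def tildeMinus (l α : ℝ) (M : Matrix (Fin 4) (Fin 8) ℂ) :
    Matrix (Fin 4) (Fin 4) ℂ :=
  M.submatrix id (Fin.castAdd 4) * W α (-l)

/-- `M⁺ W(l)`, where `M = (M⁻ M⁺)` in `4 × 4` blocks. -/
noncomputable def tildePlus (l α : ℝ) (M : Matrix (Fin 4) (Fin 8) ℂ) :
    Matrix (Fin 4) (Fin 4) ℂ :=
  M.submatrix id (Fin.natAdd 4) * W α l

/-- `M⁻ W(-l) + M⁺ W(l)`, which is invertible if and only if `M` is well-posed. -/
noncomputable def tilde (l α : ℝ) (M : Matrix (Fin 4) (Fin 8) ℂ) : Matrix (Fin 4) (Fin 4) ℂ :=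
  tildeMinus l α M + tildePlus l α M

noncomputable def GMinus (l α : ℝ) (M : Matrix (Fin 4) (Fin 8) ℂ) : Matrix (Fin 4) (Fin 4) ℂ :=
  (tilde l α M)⁻¹ * tildeMinus l α M * Omega * shiftL ^ 2

noncomputable def GPlus (l α : ℝ) (M : Matrix (Fin 4) (Fin 8) ℂ) : Matrix (Fin 4) (Fin 4) ℂ :=
  (tilde l α M)⁻¹ * tildePlus l α M * Omega * shiftL ^ 2

/-- The Green's function `G_M(x, ξ)` of `u'''' + α⁴ u = (α⁴ / k) w`, `M · B[u] = 0`,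
for a well-posed `M`. -/
noncomputable def green (l α k : ℝ) (M : Matrix (Fin 4) (Fin 8) ℂ) (x ξ : ℝ) : ℂ :=
  ((α / (4 * k) : ℝ) : ℂ) *
    if x ≤ ξ then y α x ⬝ᵥ (GPlus l α M).mulVec (y α ξ)
    else -(y α x ⬝ᵥ (GMinus l α M).mulVec (y α ξ))

theorem continuous_form (α : ℝ) (A : Matrix (Fin 4) (Fin 4) ℂ) :
    Continuous fun p : ℝ × ℝ => y α p.1 ⬝ᵥ A.mulVec (y α p.2) := by
  unfold y dotProduct Matrix.mulVec dotProduct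
  fun_prop

theorem measurable_green (l α k : ℝ) (M : Matrix (Fin 4) (Fin 8) ℂ) :
    Measurable (Function.uncurry (green l α k M)) := by
  refine Measurable.const_mul ?_ _
  exact Measurable.ite (measurableSet_le measurable_fst measurable_snd)
    (continuous_form α _).measurable (continuous_form α _).neg.measurable

theorem bounded_green (l α k : ℝ) (M : Matrix (Fin 4) (Fin 8) ℂ) :
    ∃ C : ℝ, ∀ x ∈ Icc (-l) l, ∀ ξ ∈ Icc (-l) l, ‖green l α k M x ξ‖ ≤ C := by
  have hc : IsCompact (Icc (-l) l ×ˢ Icc (-l) l) := isCompact_Icc.prod isCompact_Icc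
  obtain ⟨C₁, h₁⟩ := hc.exists_bound_of_continuousOn (continuous_form α (GPlus l α M)).continuousOn
  obtain ⟨C₂, h₂⟩ := hc.exists_bound_of_continuousOn (continuous_form α (GMinus l α M)).continuousOn
  refine ⟨‖((α / (4 * k) : ℝ) : ℂ)‖ * max C₁ C₂, fun x hx ξ hξ => ?_⟩
  unfold green
  rw [norm_mul]
  refine mul_le_mul_of_nonneg_left ?_ (norm_nonneg _)
  split_ifs
  · exact (h₁ (x, ξ) ⟨hx, hξ⟩).trans (le_max_left _ _)
  · rw [norm_neg]
    exact (h₂ (x, ξ) ⟨hx, hξ⟩).trans (le_max_right _ _)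

/-- The integral operator `K_M` on `L²[-l, l]` with kernel the Green's function `G_M`,
for a well-posed `M`. -/
noncomputable def opK (l α k : ℝ) (M : Matrix (Fin 4) (Fin 8) ℂ) : L2 l →L[ℂ] L2 l :=
  kernelOperator l (green l α k M) (measurable_green l α k M) (bounded_green l α k M)

/-! ### The special boundary condition `Q` and the operator `K_{l,α,k}` -/

/-- The boundary condition `Q`. -/
noncomputable def matQ (α : ℝ) : Matrix (Fin 4) (Fin 8) ℂ :=
  Matrix.map (β := ℂ)
    !![0, α ^ 2, -(√2 * α), 1, 0, 0, 0, 0;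
       √2 * α ^ 3, -α ^ 2, 0, 1, 0, 0, 0, 0;
       0, 0, 0, 0, 0, α ^ 2, √2 * α, 1;
       0, 0, 0, 0, -(√2 * α ^ 3), -α ^ 2, 0, 1]
    Complex.ofReal

/-- The Green's function of the infinitely long beam. -/
noncomputable def greenInf (α k x ξ : ℝ) : ℝ :=
  α / (2 * k) * Real.exp (-(α / √2) * |x - ξ|) * Real.sin (α / √2 * |x - ξ| + Real.pi / 4)

theorem continuous_greenInf (α k : ℝ) :
    Continuous (Function.uncurry fun x ξ : ℝ => (greenInf α k x ξ : ℂ)) := by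
  unfold greenInf Function.uncurry
  fun_prop

theorem bounded_greenInf (l α k : ℝ) :
    ∃ C : ℝ, ∀ x ∈ Icc (-l) l, ∀ ξ ∈ Icc (-l) l, ‖(greenInf α k x ξ : ℂ)‖ ≤ C := by
  have hc : IsCompact (Icc (-l) l ×ˢ Icc (-l) l) := isCompact_Icc.prod isCompact_Icc
  obtain ⟨C, h⟩ := hc.exists_bound_of_continuousOn (continuous_greenInf α k).continuousOn
  exact ⟨C, fun x hx ξ hξ => h (x, ξ) ⟨hx, hξ⟩⟩

/-- The integral operator `K_{l,α,k}` on `L²[-l, l]`. -/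
noncomputable def opInf (l α k : ℝ) : L2 l →L[ℂ] L2 l :=
  kernelOperator l (fun x ξ => (greenInf α k x ξ : ℂ)) (continuous_greenInf α k).measurable
    (bounded_greenInf l α k)

/-! ### Positivity and contractivity -/

/-- `K` is positive: all its intrinsic eigenvalues `k · μ` are positive real numbers. -/
def IsPos {l : ℝ} (k : ℝ) (K : L2 l →L[ℂ] L2 l) : Prop :=
  ∀ μ ∈ Spec K, ∃ r : ℝ, 0 < r ∧ (k : ℂ) * μ = (r : ℂ)

/-- `K` is contractive: its intrinsic `L²`-norm `k · ‖K‖` is less than `1`. -/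
def IsContractive {l : ℝ} (k : ℝ) (K : L2 l →L[ℂ] L2 l) : Prop :=
  k * ‖K‖ < 1

end Beam

namespace Beam

open MeasureTheory Set

/-! ### The fourth roots of `-1` -/

/-! The carrying fact is that every real `lam ≠ 0` is an eigenvalue of `opK` for some real
well-posed `M`. By `setIntegral_green_mul` (variation of parameters), an eigenfunction is a nonzero
`u` with `u'''' = κ u`, `κ = α⁴/(k lam) - α⁴ ≠ -α⁴`, satisfying the boundary condition. It thus
suffices to fix `u` and build `M` around its boundary data `(p, q)`.

Solutions of `u'''' + α⁴ u = 0` have data `(p, T p)` with `T = transfer l α`, and well-posedness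
means that `M` is injective on this graph. If `q ≠ T p`, linear algebra gives a real `M` that kills
`(p, q)` and stays injective on the graph (`exists_boundary_condition`). Such a real `u` exists
(`exists_real_solution`): a suitable exponential `e^{rx}`, `r⁴ = κ`, is scaled differently by `T`
than by the step from `-l` to `l`.

For `Q`, the left conditions kill the exponentials with `Re ω_j > 0` and the right ones those with
`Re ω_j < 0`, so the Green's function keeps only exponentials decaying in `|x - ξ|`. Finally `lam =
-1/k` violates both positivity and contractivity. -/

theorem omega_eq (j : Fin 4) :
    omega j = ((√2 / 2 : ℝ) + (√2 / 2 : ℝ) * Complex.I) * Complex.I ^ (j : ℕ) := by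
  have h : omega j = Complex.exp ((Real.pi / 4 : ℝ) * Complex.I) *
      Complex.exp (Real.pi / 2 * Complex.I) ^ (j : ℕ) := by
    rw [omega, ← Complex.exp_nat_mul, ← Complex.exp_add]
    congr 1
    push_cast
    ring
  rw [h, Complex.exp_pi_div_two_mul_I, Complex.exp_mul_I, ← Complex.ofReal_cos,
    ← Complex.ofReal_sin, Real.cos_pi_div_four, Real.sin_pi_div_four]

theorem ofReal_sqrt_two_sq : ((√2 : ℝ) : ℂ) ^ 2 = 2 := by
  rw [← Complex.ofReal_pow, Real.sq_sqrt (by norm_num)]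
  norm_num

theorem omega_zero_sq : omega 0 ^ 2 = Complex.I := by
  rw [omega_eq]
  simp only [Fin.val_zero, pow_zero, mul_one]
  push_cast
  linear_combination (1 / 4 * (1 + Complex.I) ^ 2) * ofReal_sqrt_two_sq +
    (1 / 2 : ℂ) * Complex.I_sq

theorem omega_eq_mul_I_pow (j : Fin 4) : omega j = omega 0 * Complex.I ^ (j : ℕ) := by
  rw [omega_eq, omega_eq]
  simp

theorem omega_pow_four (j : Fin 4) : omega j ^ 4 = -1 := by
  rw [omega_eq_mul_I_pow, mul_pow, ← pow_mul, mul_comm (j : ℕ), pow_mul, Complex.I_pow_four,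
    one_pow, mul_one]
  calc omega 0 ^ 4 = (omega 0 ^ 2) ^ 2 := by ring
    _ = -1 := by rw [omega_zero_sq, Complex.I_sq]

theorem omega_ne_zero (j : Fin 4) : omega j ≠ 0 := Complex.exp_ne_zero _

theorem omega_add_two (j : Fin 4) : omega (j + 2) = -omega j := by
  rw [omega_eq_mul_I_pow, omega_eq_mul_I_pow j]
  fin_cases j <;> simp [pow_succ]

theorem star_omega (j : Fin 4) : star (omega j) = omega j.rev := by
  rw [omega_eq, omega_eq]
  fin_cases j <;> simp [Fin.rev, Complex.ext_iff, pow_succ]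

theorem omega_re_sq (j : Fin 4) : (omega j).re ^ 2 = 1 / 2 := by
  have h : (√2 : ℝ) ^ 2 = 2 := Real.sq_sqrt (by norm_num)
  rw [omega_eq]
  fin_cases j <;> simp [pow_succ] <;> nlinarith

/-- The roots `±1 ± i`, up to the factor `√2 / 2`, split according to the sign of the real part. -/
theorem omega_sq_sub (j : Fin 4) (hj : j = 0 ∨ j = 3) : omega j ^ 2 - √2 * omega j + 1 = 0 := by
  have h := ofReal_sqrt_two_sq
  have hI := Complex.I_sq
  rw [omega_eq]
  rcases hj with rfl | rfl <;> push_cast <;> simp [pow_succ] <;> grind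

theorem omega_sq_add (j : Fin 4) (hj : j = 1 ∨ j = 2) : omega j ^ 2 + √2 * omega j + 1 = 0 := by
  have h := omega_sq_sub (j + 2) (by rcases hj with rfl | rfl <;> simp)
  rw [omega_add_two] at h
  linear_combination h

theorem omega_zero_ne_three : omega 0 ≠ omega 3 := by
  rw [omega_eq, omega_eq]
  intro h
  have := congrArg Complex.im h
  simp [pow_succ] at this
  have := Real.sqrt_pos.2 (show (0 : ℝ) < 2 by norm_num)
  linarith

theorem omega_one_ne_two : omega 1 ≠ omega 2 := by
  have h3 := omega_add_two 1
  have h0 := omega_add_two 2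
  simp only [show (1 : Fin 4) + 2 = 3 from rfl, show (2 : Fin 4) + 2 = 0 from rfl] at h3 h0
  intro h
  exact omega_zero_ne_three (by rw [h0, h3, h])

/-! ### Coordinates in the fundamental system -/

/-- The vector `W(x)⁻¹ v`. -/
noncomputable def coeff (α x : ℝ) (v : Fin 4 → ℂ) (j : Fin 4) : ℂ :=
  -(1 / (4 * (α : ℂ) ^ 4)) * Complex.exp (-(omega j * α * x)) *
    ((omega j * α) ^ 4 * v 0 + (omega j * α) ^ 3 * v 1 + (omega j * α) ^ 2 * v 2 +
      (omega j * α) * v 3)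

/-- Discrete Fourier inversion: the numbers `z_j = ω_j α` are the four roots of `z⁴ = -α⁴`, and the
sum of `z_j ^ m` vanishes unless 4 divides `m`. Only `v i` survives in row `i`, with factor `4 z⁴ =
-4 α⁴`. -/
theorem W_mulVec_coeff {α : ℝ} (hα : α ≠ 0) (x : ℝ) (v : Fin 4 → ℂ) :
    (W α x).mulVec (coeff α x v) = v := by
  have hα' : (α : ℂ) ≠ 0 := Complex.ofReal_ne_zero.2 hα
  have key : ∀ j i, W α x i j * coeff α x v j =
      -(1 / (4 * (α : ℂ) ^ 4)) * ((omega j * α) ^ (i : ℕ) *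
        ((omega j * α) ^ 4 * v 0 + (omega j * α) ^ 3 * v 1 + (omega j * α) ^ 2 * v 2 +
        (omega j * α) * v 3)) := by
    intro j i
    have he : y α x j * Complex.exp (-(omega j * α * x)) = 1 := by
      rw [y, ← Complex.exp_add]
      simp
    simp only [W, Matrix.of_apply, coeff]
    linear_combination (-(1 / (4 * (α : ℂ) ^ 4)) * ((omega j * α) ^ (i : ℕ) *
        ((omega j * α) ^ 4 * v 0 + (omega j * α) ^ 3 * v 1 + (omega j * α) ^ 2 * v 2 +
        (omega j * α) * v 3))) * he
  have h2 := omega_zero_sq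
  have hI := Complex.I_sq
  have h1 := omega_eq_mul_I_pow 1
  have h22 := omega_eq_mul_I_pow 2
  have h3 := omega_eq_mul_I_pow 3
  funext i
  simp only [Matrix.mulVec, dotProduct, key, Fin.sum_univ_four, h1, h22, h3]
  have e : Complex.I = omega 0 ^ 2 := h2.symm
  have h8 : omega 0 ^ 4 = -1 := omega_pow_four 0
  generalize omega 0 = z at *
  fin_cases i <;> simp <;> field_simp <;> rw [e] <;> grind

theorem W_det_isUnit {α : ℝ} (hα : α ≠ 0) (x : ℝ) : IsUnit (W α x).det := by
  rw [← Matrix.isUnit_iff_isUnit_det, ← Matrix.mulVec_surjective_iff_isUnit]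
  exact fun v => ⟨_, W_mulVec_coeff hα x v⟩

theorem coeff_W_mulVec {α : ℝ} (hα : α ≠ 0) (x : ℝ) (c : Fin 4 → ℂ) :
    coeff α x ((W α x).mulVec c) = c := by
  have hinj : Function.Injective (W α x).mulVec :=
    Matrix.mulVec_injective_iff_isUnit.2
      ((Matrix.isUnit_iff_isUnit_det _).2 (W_det_isUnit hα x))
  exact hinj (W_mulVec_coeff hα x _)

theorem W_mulVec_zero (α x : ℝ) (c : Fin 4 → ℂ) : (W α x).mulVec c 0 = y α x ⬝ᵥ c := by
  simp [Matrix.mulVec, dotProduct, W]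

/-- Variation of parameters. -/
theorem hasDerivWithinAt_coeff {α x : ℝ} {S : Set ℝ} {U : ℝ → Fin 4 → ℂ} {f : ℂ}
    (h0 : HasDerivWithinAt (fun x => U x 0) (U x 1) S x)
    (h1 : HasDerivWithinAt (fun x => U x 1) (U x 2) S x)
    (h2 : HasDerivWithinAt (fun x => U x 2) (U x 3) S x)
    (h3 : HasDerivWithinAt (fun x => U x 3) (f - (α : ℂ) ^ 4 * U x 0) S x) (j : Fin 4) :
    HasDerivWithinAt (fun x => coeff α x (U x) j)
      (-(1 / (4 * (α : ℂ) ^ 4)) * (omega j * α * Complex.exp (-(omega j * α * x)) * f)) S x := by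
  have hx : HasDerivWithinAt (fun x : ℝ => -(omega j * α * (x : ℂ))) (-(omega j * α)) S x := by
    have := ((Complex.ofRealCLM.hasDerivAt (x := x)).const_mul (omega j * α)).neg
    exact (this.congr_deriv (by simp)).hasDerivWithinAt
  have hE := (hx.cexp.const_mul (-(1 / (4 * (α : ℂ) ^ 4)))).mul
    ((((h0.const_mul ((omega j * α) ^ 4)).add (h1.const_mul ((omega j * α) ^ 3))).add
      (h2.const_mul ((omega j * α) ^ 2))).add (h3.const_mul (omega j * α)))
  refine hE.congr_deriv ?_
  -- The terms in `U x 1`, `U x 2`, `U x 3` telescope; the two remaining terms in `U x 0` cancel by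
  -- this identity.
  have h4 : (omega j * α) ^ 4 = -(α : ℂ) ^ 4 := by
    rw [mul_pow, omega_pow_four]
    ring
  simp only [Pi.add_apply]
  linear_combination (Complex.exp (-(omega j * α * x)) * (1 / (4 * (α : ℂ) ^ 4)) * omega j * α *
    U x 0) * h4

/-! ### Boundary conditions -/

theorem mulVec_append (M : Matrix (Fin 4) (Fin 8) ℂ) (a b : Fin 4 → ℂ) :
    M.mulVec (Fin.append (m := 4) (n := 4) a b) =
      (M.submatrix id (Fin.castAdd 4)).mulVec a + (M.submatrix id (Fin.natAdd 4)).mulVec b := by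
  funext i
  simp only [Matrix.mulVec, dotProduct, Pi.add_apply]
  rw [Fin.sum_univ_add (fun j : Fin (4 + 4) => M i j * Fin.append (m := 4) (n := 4) a b j)]
  simp only [Fin.append_left, Fin.append_right, Matrix.submatrix_apply, id]

/-- With zero forcing, variation of parameters makes the coordinate vector `c` of `u` constant, and
the boundary condition becomes `tilde l α M` applied to `c` equals 0. -/
theorem isWellPosed_of_isUnit {l α : ℝ} (hl : 0 < l) (hα : α ≠ 0)
    {M : Matrix (Fin 4) (Fin 8) ℂ} (hM : IsUnit (tilde l α M).det) : IsWellPosed l α M := by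
  intro u hu hode hB
  have hlt : -l < l := by linarith
  set S := Icc (-l) l with hS
  have hun : UniqueDiffOn ℝ S := uniqueDiffOn_Icc hlt
  set U : ℝ → Fin 4 → ℂ := fun x i => iteratedDerivWithin i u S x with hU
  have hd : ∀ n : ℕ, n < 4 → ∀ x ∈ S, HasDerivWithinAt (fun x => iteratedDerivWithin n u S x)
      (iteratedDerivWithin (n + 1) u S x) S x := by
    intro n hn x hx
    have := (hu.differentiableOn_iteratedDerivWithin (m := n) (by exact_mod_cast hn) hun) x hx
    rw [iteratedDerivWithin_succ]
    exact this.hasDerivWithinAt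
  have hc : ∀ j, ∀ x ∈ S, HasDerivWithinAt (fun x => coeff α x (U x) j) 0 S x := by
    intro j x hx
    have := hasDerivWithinAt_coeff (α := α) (U := U) (f := 0) (hd 0 (by norm_num) x hx)
      (hd 1 (by norm_num) x hx) (hd 2 (by norm_num) x hx)
      ((hd 3 (by norm_num) x hx).congr_deriv ?_) j
    · simpa using this
    · have := hode x hx
      simp only [hU]
      simp only [Fin.val_zero, iteratedDerivWithin_zero]
      linear_combination this
  have hconst : ∀ x ∈ S, coeff α x (U x) = coeff α (-l) (U (-l)) := by
    intro x hx
    funext j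
    refine constant_of_has_deriv_right_zero (fun x hx => (hc j x hx).continuousWithinAt)
      (fun x hx => ?_) x hx
    exact ((hc j x ⟨hx.1, hx.2.le⟩).mono_of_mem_nhdsWithin (Icc_mem_nhdsGE_of_mem hx))
  set c := coeff α (-l) (U (-l)) with hcdef
  have hUx : ∀ x ∈ S, U x = (W α x).mulVec c := by
    intro x hx
    rw [← hconst x hx, W_mulVec_coeff hα]
  have hc0 : c = 0 := by
    have h : (tilde l α M).mulVec c = 0 := by
      rw [← hB, boundaryData, mulVec_append]
      change _ = (M.submatrix id (Fin.castAdd 4)).mulVec (U (-l)) +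
        (M.submatrix id (Fin.natAdd 4)).mulVec (U l)
      rw [hUx (-l) ⟨le_rfl, hlt.le⟩, hUx l ⟨hlt.le, le_rfl⟩, tilde, Matrix.add_mulVec, tildeMinus,
        tildePlus, Matrix.mulVec_mulVec, Matrix.mulVec_mulVec]
    exact Matrix.mulVec_injective_iff_isUnit.2 ((Matrix.isUnit_iff_isUnit_det _).2 hM)
      (by rw [h, Matrix.mulVec_zero])
  intro x hx
  have := congrFun (hUx x hx) 0
  rw [hc0, Matrix.mulVec_zero] at this
  simpa [hU] using this

/-! ### The Green's function inverts the boundary value problem -/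

/-- Shifting the index by two negates `ω_j`. Up to a scalar this vector is the last column of
`W(ξ)⁻¹`, through which a forcing term enters the coordinates. -/
theorem Omega_mul_shiftL_sq_mulVec_y (α ξ : ℝ) (j : Fin 4) :
    (Omega * shiftL ^ 2).mulVec (y α ξ) j = omega j * Complex.exp (-(omega j * α * ξ)) := by
  have h : (shiftL ^ 2).mulVec (y α ξ) j = y α ξ (j + 2) := by
    rw [pow_two, ← Matrix.mulVec_mulVec]
    fin_cases j <;> simp [shiftL, Matrix.mulVec, dotProduct, Fin.sum_univ_four]
  rw [← Matrix.mulVec_mulVec, Omega, Matrix.mulVec_diagonal, h, y, omega_add_two]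
  ring_nf

theorem hasDerivAt_dotProduct_mulVec {c c' : ℝ → Fin 4 → ℂ}
    (hc : ∀ j x, HasDerivAt (fun x => c x j) (c' x j) x) (v : Fin 4 → ℂ)
    (A : Matrix (Fin 4) (Fin 4) ℂ) (x : ℝ) :
    HasDerivAt (fun ξ => v ⬝ᵥ A.mulVec (c ξ)) (v ⬝ᵥ A.mulVec (c' x)) x := by
  simp only [dotProduct, Matrix.mulVec]
  exact HasDerivAt.fun_sum fun i _ => HasDerivAt.const_mul _
    (HasDerivAt.fun_sum fun j _ => (hc j x).const_mul _)

/-- On either side of `x` the integrand is the `ξ`-derivative of a constant times `y(x) · A c(ξ)` or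
`y(x) · B c(ξ)`, where `c(ξ) = W(ξ)⁻¹ U(ξ)`. After integration, `A c(l) + B c(-l) = 0` (the boundary
condition) removes the end points, and `A + B = 1` leaves `y(x) · c(x) = U x 0`. -/
theorem setIntegral_green_mul {l α k : ℝ} (hα : α ≠ 0)
    {M : Matrix (Fin 4) (Fin 8) ℂ} (hM : IsUnit (tilde l α M).det) {U : ℝ → Fin 4 → ℂ}
    {f : ℝ → ℂ} (hf : Continuous f)
    (h0 : ∀ x, HasDerivAt (fun x => U x 0) (U x 1) x)
    (h1 : ∀ x, HasDerivAt (fun x => U x 1) (U x 2) x)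
    (h2 : ∀ x, HasDerivAt (fun x => U x 2) (U x 3) x)
    (h3 : ∀ x, HasDerivAt (fun x => U x 3) (f x - (α : ℂ) ^ 4 * U x 0) x)
    (hB : M.mulVec (Fin.append (m := 4) (n := 4) (U (-l)) (U l)) = 0) {x : ℝ}
    (hx : x ∈ Icc (-l) l) :
    ∫ ξ in Icc (-l) l, green l α k M x ξ * f ξ = (α : ℂ) ^ 4 / k * U x 0 := by
  have hα' : (α : ℂ) ≠ 0 := Complex.ofReal_ne_zero.2 hα
  set c : ℝ → Fin 4 → ℂ := fun ξ => coeff α ξ (U ξ) with hcdef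
  set c' : ℝ → Fin 4 → ℂ := fun ξ j => -(1 / (4 * (α : ℂ) ^ 4)) *
    (omega j * α * Complex.exp (-(omega j * α * ξ)) * f ξ) with hc'def
  have hc : ∀ j ξ, HasDerivAt (fun ξ => c ξ j) (c' ξ j) ξ := by
    intro j ξ
    rw [← hasDerivWithinAt_univ]
    exact hasDerivWithinAt_coeff (h0 ξ).hasDerivWithinAt (h1 ξ).hasDerivWithinAt
      (h2 ξ).hasDerivWithinAt (h3 ξ).hasDerivWithinAt j
  have hc'c : Continuous c' := by
    refine continuous_pi fun j => ?_
    simp only [hc'def]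
    fun_prop
  set A := (tilde l α M)⁻¹ * tildePlus l α M with hA
  set B := (tilde l α M)⁻¹ * tildeMinus l α M with hB'
  have hvec : ∀ ξ, f ξ • (Omega * shiftL ^ 2).mulVec (y α ξ) = (-4 * (α : ℂ) ^ 3) • c' ξ := by
    intro ξ
    funext j
    simp only [Pi.smul_apply, Omega_mul_shiftL_sq_mulVec_y, hc'def, smul_eq_mul]
    field_simp
  have hform : ∀ (D : Matrix (Fin 4) (Fin 4) ℂ) ξ,
      y α x ⬝ᵥ (D * Omega * shiftL ^ 2).mulVec (y α ξ) * f ξ =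
        (-4 * (α : ℂ) ^ 3) * (y α x ⬝ᵥ D.mulVec (c' ξ)) := by
    intro D ξ
    rw [← smul_eq_mul (-4 * (α : ℂ) ^ 3), ← dotProduct_smul, ← Matrix.mulVec_smul, ← hvec,
      Matrix.mulVec_smul, dotProduct_smul, Matrix.mulVec_mulVec, ← mul_assoc, smul_eq_mul, mul_comm]
  have hcont : ∀ D : Matrix (Fin 4) (Fin 4) ℂ,
      Continuous fun ξ => y α x ⬝ᵥ D.mulVec (c' ξ) := fun D =>
    (continuous_const.dotProduct (Continuous.matrix_mulVec continuous_const hc'c))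
  have hR : ∀ ξ ∈ Icc x l, green l α k M x ξ * f ξ =
      -((α : ℂ) ^ 4 / k) * (y α x ⬝ᵥ A.mulVec (c' ξ)) := by
    intro ξ hξ
    rw [green, if_pos hξ.1, GPlus]
    push_cast
    linear_combination (α / (4 * k) : ℂ) * hform A ξ
  have hL : ∀ ξ ∈ Ico (-l) x, green l α k M x ξ * f ξ =
      ((α : ℂ) ^ 4 / k) * (y α x ⬝ᵥ B.mulVec (c' ξ)) := by
    intro ξ hξ
    rw [green, if_neg (not_le.2 hξ.2), GMinus]
    push_cast
    linear_combination -(α / (4 * k) : ℂ) * hform B ξ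
  have hFTC : ∀ (D : Matrix (Fin 4) (Fin 4) ℂ) (z : ℂ) (a b : ℝ),
      ∫ ξ in a..b, z * (y α x ⬝ᵥ D.mulVec (c' ξ)) =
        z * (y α x ⬝ᵥ D.mulVec (c b - c a)) := by
    intro D z a b
    rw [intervalIntegral.integral_const_mul, intervalIntegral.integral_eq_sub_of_hasDerivAt
      (fun ξ _ => hasDerivAt_dotProduct_mulVec hc (y α x) D ξ)
      ((hcont D).intervalIntegrable _ _), Matrix.mulVec_sub, dotProduct_sub]
  have hAB : A + B = 1 := by
    rw [hA, hB', ← mul_add, add_comm, ← tilde, Matrix.nonsing_inv_mul _ hM]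
  have hbc : A.mulVec (c l) + B.mulVec (c (-l)) = 0 := by
    rw [hA, hB', ← Matrix.mulVec_mulVec, ← Matrix.mulVec_mulVec, ← Matrix.mulVec_add, tildePlus,
      tildeMinus, ← Matrix.mulVec_mulVec, ← Matrix.mulVec_mulVec]
    simp only [hcdef, W_mulVec_coeff hα]
    rw [add_comm, ← mulVec_append, hB, Matrix.mulVec_zero]
  rw [← Ico_union_Icc_eq_Icc hx.1 hx.2, setIntegral_union
    (disjoint_left.2 fun _ h h' => (h.2.trans_le h'.1).false) measurableSet_Icc,
    setIntegral_congr_fun measurableSet_Ico hL, setIntegral_congr_fun measurableSet_Icc hR,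
    integral_Ico_eq_integral_Ioc, integral_Icc_eq_integral_Ioc,
    ← intervalIntegral.integral_of_le hx.1, ← intervalIntegral.integral_of_le hx.2, hFTC, hFTC]
  · have e0 : U x 0 = y α x ⬝ᵥ c x := by
      rw [← W_mulVec_zero, hcdef, W_mulVec_coeff hα]
    have e1 : y α x ⬝ᵥ A.mulVec (c l) + y α x ⬝ᵥ B.mulVec (c (-l)) = 0 := by
      rw [← dotProduct_add, hbc, dotProduct_zero]
    have e2 : y α x ⬝ᵥ A.mulVec (c x) + y α x ⬝ᵥ B.mulVec (c x) = y α x ⬝ᵥ c x := by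
      rw [← dotProduct_add, ← Matrix.add_mulVec, hAB, Matrix.one_mulVec]
    rw [e0, Matrix.mulVec_sub, Matrix.mulVec_sub, dotProduct_sub, dotProduct_sub]
    linear_combination ((α : ℂ) ^ 4 / k) * e2 - ((α : ℂ) ^ 4 / k) * e1
  · exact (((continuous_const.mul (hcont B)).integrableOn_Icc.mono_set Ico_subset_Icc_self)).congr_fun
      (fun ξ hξ => (hL ξ hξ).symm) measurableSet_Ico
  · exact ((continuous_const.mul (hcont A)).integrableOn_Icc).congr_fun
      (fun ξ hξ => (hR ξ hξ).symm) measurableSet_Icc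

/-! ### The infinitely long beam -/

theorem submatrix_castAdd_matQ (α : ℝ) : (matQ α).submatrix id (Fin.castAdd 4) =
    !![0, (α : ℂ) ^ 2, -(√2 * α), 1; √2 * (α : ℂ) ^ 3, -(α : ℂ) ^ 2, 0, 1;
      0, 0, 0, 0; 0, 0, 0, 0] := by
  ext i j
  fin_cases i <;> fin_cases j <;> simp [matQ, Fin.castAdd, Fin.castLE]

theorem submatrix_natAdd_matQ (α : ℝ) : (matQ α).submatrix id (Fin.natAdd 4) =
    !![0, 0, 0, 0; 0, 0, 0, 0; 0, (α : ℂ) ^ 2, √2 * α, 1;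
      -(√2 * (α : ℂ) ^ 3), -(α : ℂ) ^ 2, 0, 1] := by
  ext i j
  fin_cases i <;> fin_cases j <;> simp [matQ, Fin.natAdd]

/-- Read as polynomials in `d/dx`, the first two rows of `Q` share the factor `s² - √2 α s + α²`,
with cofactors `s` and `s + √2 α`. Its roots are `ω_j α` with `Re ω_j > 0`, so those columns vanish.
-/
theorem tildeMinus_matQ_apply (l α : ℝ) (j : Fin 4) :
    (tildeMinus l α (matQ α) 0 j =
        α ^ 3 * omega j * (omega j ^ 2 - √2 * omega j + 1) * y α (-l) j ∧
      tildeMinus l α (matQ α) 1 j =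
        α ^ 3 * (omega j + √2) * (omega j ^ 2 - √2 * omega j + 1) * y α (-l) j) ∧
    (tildeMinus l α (matQ α) 2 j = 0 ∧ tildeMinus l α (matQ α) 3 j = 0) := by
  have h := ofReal_sqrt_two_sq
  simp [tildeMinus, submatrix_castAdd_matQ, Matrix.mul_apply, Fin.sum_univ_four, W]
  constructor
  · ring
  · linear_combination ((α : ℂ) ^ 3 * omega j * y α (-l) j) * h

theorem tildePlus_matQ_apply (l α : ℝ) (j : Fin 4) :
    (tildePlus l α (matQ α) 0 j = 0 ∧ tildePlus l α (matQ α) 1 j = 0) ∧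
    (tildePlus l α (matQ α) 2 j =
        α ^ 3 * omega j * (omega j ^ 2 + √2 * omega j + 1) * y α l j ∧
      tildePlus l α (matQ α) 3 j =
        α ^ 3 * (omega j - √2) * (omega j ^ 2 + √2 * omega j + 1) * y α l j) := by
  have h := ofReal_sqrt_two_sq
  simp [tildePlus, submatrix_natAdd_matQ, Matrix.mul_apply, Fin.sum_univ_four, W]
  constructor
  · ring
  · linear_combination ((α : ℂ) ^ 3 * omega j * y α l j) * h

/-- The system decouples: rows 0, 1 involve only coordinates 1, 2, and rows 2, 3 only coordinates 0,
3. Each 2 × 2 block is nonsingular because its two roots differ. -/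
theorem isUnit_tilde_matQ (l : ℝ) {α : ℝ} (hα : α ≠ 0) : IsUnit (tilde l α (matQ α)).det := by
  have hα' : (α : ℂ) ≠ 0 := Complex.ofReal_ne_zero.2 hα
  have hs : ((√2 : ℝ) : ℂ) ≠ 0 := Complex.ofReal_ne_zero.2 (by positivity)
  rw [← Matrix.isUnit_iff_isUnit_det, ← Matrix.mulVec_injective_iff_isUnit]
  refine (injective_iff_map_eq_zero (tilde l α (matQ α)).mulVecLin).2 fun c hc => ?_
  have m := tildeMinus_matQ_apply l α
  have p := tildePlus_matQ_apply l α
  have m0 := omega_sq_sub 0 (by simp)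
  have m3 := omega_sq_sub 3 (by simp)
  have p1 := omega_sq_add 1 (by simp)
  have p2 := omega_sq_add 2 (by simp)
  have r := congrFun hc
  simp only [Matrix.mulVecLin_apply, Matrix.mulVec, dotProduct, Fin.sum_univ_four, tilde,
    Matrix.add_apply, Pi.zero_apply] at r
  have r0 := r 0
  have r1 := r 1
  have r2 := r 2
  have r3 := r 3
  simp only [fun j => (m j).1.1, fun j => (m j).1.2, fun j => (m j).2.1, fun j => (m j).2.2,
    fun j => (p j).1.1, fun j => (p j).1.2, fun j => (p j).2.1, fun j => (p j).2.2,
    m0, m3, p1, p2, mul_zero, zero_mul, add_zero, zero_add] at r0 r1 r2 r3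
  have n : ∀ j x, y α x j ≠ 0 := fun j x => Complex.exp_ne_zero _
  have w := omega_ne_zero
  have e1 : omega 1 ^ 2 - √2 * omega 1 + 1 ≠ 0 := by
    have : omega 1 ^ 2 - √2 * omega 1 + 1 = -2 * √2 * omega 1 := by linear_combination p1
    rw [this]
    exact mul_ne_zero (mul_ne_zero (by norm_num) hs) (w 1)
  have e2 : omega 2 ^ 2 - √2 * omega 2 + 1 ≠ 0 := by
    have : omega 2 ^ 2 - √2 * omega 2 + 1 = -2 * √2 * omega 2 := by linear_combination p2
    rw [this]
    exact mul_ne_zero (mul_ne_zero (by norm_num) hs) (w 2)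
  have e0 : omega 0 ^ 2 + √2 * omega 0 + 1 ≠ 0 := by
    have : omega 0 ^ 2 + √2 * omega 0 + 1 = 2 * √2 * omega 0 := by linear_combination m0
    rw [this]
    exact mul_ne_zero (mul_ne_zero (by norm_num) hs) (w 0)
  have e3 : omega 3 ^ 2 + √2 * omega 3 + 1 ≠ 0 := by
    have : omega 3 ^ 2 + √2 * omega 3 + 1 = 2 * √2 * omega 3 := by linear_combination m3
    rw [this]
    exact mul_ne_zero (mul_ne_zero (by norm_num) hs) (w 3)
  -- The determinant of the rows `(a, b)` and `(a + t, b + t)` is `t (a - b)`.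
  have aux : ∀ a b d d' t : ℂ, a ≠ b → t ≠ 0 → a * d + b * d' = 0 →
      (a + t) * d + (b + t) * d' = 0 → d = 0 ∧ d' = 0 := by
    intro a b d d' t hab ht h h'
    have hsum : d + d' = 0 := by
      have : t * (d + d') = 0 := by linear_combination h' - h
      exact (mul_eq_zero.1 this).resolve_left ht
    have hd : d = 0 := by
      have : (a - b) * d = 0 := by linear_combination h - b * hsum
      exact (mul_eq_zero.1 this).resolve_left (sub_ne_zero.2 hab)
    exact ⟨hd, by simpa [hd] using hsum⟩
  have hα3 := pow_ne_zero 3 hα'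
  obtain ⟨d1, d2⟩ := aux (omega 1) (omega 2)
    (α ^ 3 * (omega 1 ^ 2 - √2 * omega 1 + 1) * y α (-l) 1 * c 1)
    (α ^ 3 * (omega 2 ^ 2 - √2 * omega 2 + 1) * y α (-l) 2 * c 2) √2 omega_one_ne_two hs
    (by linear_combination r0) (by linear_combination r1)
  obtain ⟨d0, d3⟩ := aux (omega 0) (omega 3)
    (α ^ 3 * (omega 0 ^ 2 + √2 * omega 0 + 1) * y α l 0 * c 0)
    (α ^ 3 * (omega 3 ^ 2 + √2 * omega 3 + 1) * y α l 3 * c 3) (-√2) omega_zero_ne_three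
    (neg_ne_zero.2 hs) (by linear_combination r2) (by linear_combination r3)
  simp only [mul_eq_zero, hα3, e0, e1, e2, e3, n, false_or] at d0 d1 d2 d3
  funext j
  fin_cases j <;> simp [d0, d1, d2, d3]

/-- The two summands of `tilde` have complementary column supports, so multiplying by `tilde⁻¹`
turns each into a coordinate projection. -/
theorem tilde_matQ_mul_diagonal (l α : ℝ) :
    tilde l α (matQ α) * Matrix.diagonal ![1, 0, 0, 1] = tildePlus l α (matQ α) ∧
      tilde l α (matQ α) * Matrix.diagonal ![0, 1, 1, 0] = tildeMinus l α (matQ α) := by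
  have m := tildeMinus_matQ_apply l α
  have p := tildePlus_matQ_apply l α
  have m0 := omega_sq_sub 0 (by simp)
  have m3 := omega_sq_sub 3 (by simp)
  have p1 := omega_sq_add 1 (by simp)
  have p2 := omega_sq_add 2 (by simp)
  constructor <;> ext i j <;> rw [Matrix.mul_diagonal, tilde, Matrix.add_apply] <;>
  fin_cases i <;> fin_cases j <;>
  simp [fun j => (m j).1.1, fun j => (m j).1.2, fun j => (m j).2.1, fun j => (m j).2.2,
    fun j => (p j).1.1, fun j => (p j).1.2, fun j => (p j).2.1, fun j => (p j).2.2, m0, m3, p1, p2]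

theorem omega_mul_exp_add_conj (j : Fin 4) (t : ℝ) :
    omega j * Complex.exp (omega j * t) + omega j.rev * Complex.exp (omega j.rev * t) =
      ((2 * (omega j * Complex.exp (omega j * t)).re : ℝ) : ℂ) := by
  rw [Complex.ofReal_mul, Complex.ofReal_ofNat, ← star_omega, Complex.star_def]
  have h : Complex.exp ((starRingEnd ℂ) (omega j) * t) =
      (starRingEnd ℂ) (Complex.exp (omega j * t)) := by
    rw [← Complex.exp_conj, map_mul, Complex.conj_ofReal]
  rw [h, ← map_mul, Complex.add_conj]
  push_cast
  rfl

/-- On each side of the diagonal one conjugate pair of exponentials survives, the one decaying in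
`|x - ξ|`, and it sums to twice a real part. -/
theorem green_matQ {l α : ℝ} (hα : 0 < α) (k x ξ : ℝ) :
    green l α k (matQ α) x ξ = greenInf α k x ξ := by
  have hu := isUnit_tilde_matQ l hα.ne'
  have hP : (tilde l α (matQ α))⁻¹ * tildePlus l α (matQ α) = Matrix.diagonal ![1, 0, 0, 1] := by
    rw [← (tilde_matQ_mul_diagonal l α).1, ← mul_assoc, Matrix.nonsing_inv_mul _ hu, one_mul]
  have hN : (tilde l α (matQ α))⁻¹ * tildeMinus l α (matQ α) =
      Matrix.diagonal ![0, 1, 1, 0] := by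
    rw [← (tilde_matQ_mul_diagonal l α).2, ← mul_assoc, Matrix.nonsing_inv_mul _ hu, one_mul]
  have hprod : ∀ j, y α x j * (omega j * Complex.exp (-(omega j * α * ξ))) =
      omega j * Complex.exp (omega j * ((α * (x - ξ) : ℝ) : ℂ)) := by
    intro j
    rw [y, mul_left_comm, ← Complex.exp_add]
    push_cast
    ring_nf
  have h2 : (√2 : ℝ) ^ 2 = 2 := Real.sq_sqrt (by norm_num)
  have hs : √2 / 2 = 1 / √2 := by
    have : √2 ≠ 0 := by positivity
    field_simp
    exact h2
  rw [green, GPlus, GMinus, hP, hN, mul_assoc, mul_assoc (Matrix.diagonal ![0, 1, 1, 0]),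
    ← Matrix.mulVec_mulVec _ (Matrix.diagonal ![1, 0, 0, 1]),
    ← Matrix.mulVec_mulVec _ (Matrix.diagonal ![0, 1, 1, 0]), greenInf]
  split_ifs with h
  · have e : y α x ⬝ᵥ (Matrix.diagonal ![1, 0, 0, 1]).mulVec
        ((Omega * shiftL ^ 2).mulVec (y α ξ)) =
        omega 0 * Complex.exp (omega 0 * ((α * (x - ξ) : ℝ) : ℂ)) +
          omega (Fin.rev 0) * Complex.exp (omega (Fin.rev 0) * ((α * (x - ξ) : ℝ) : ℂ)) := by
      simp only [dotProduct, Matrix.mulVec_diagonal, Omega_mul_shiftL_sq_mulVec_y,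
        Fin.sum_univ_four]
      rw [← hprod, ← hprod]
      simp [Fin.rev]
    rw [e, omega_mul_exp_add_conj, abs_of_nonpos (by linarith), ← Complex.ofReal_mul]
    congr 1
    have ha : -(α / √2) * -(x - ξ) = √2 / 2 * (α * (x - ξ)) := by rw [hs]; ring
    have hb : α / √2 * -(x - ξ) = -(√2 / 2 * (α * (x - ξ))) := by rw [hs]; ring
    rw [ha, hb, omega_eq, Real.sin_add, Real.sin_pi_div_four, Real.cos_pi_div_four,
      Real.sin_neg, Real.cos_neg]
    simp [Complex.exp_re, Complex.exp_im]
    ring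
  · have e : y α x ⬝ᵥ (Matrix.diagonal ![0, 1, 1, 0]).mulVec
        ((Omega * shiftL ^ 2).mulVec (y α ξ)) =
        omega 1 * Complex.exp (omega 1 * ((α * (x - ξ) : ℝ) : ℂ)) +
          omega (Fin.rev 1) * Complex.exp (omega (Fin.rev 1) * ((α * (x - ξ) : ℝ) : ℂ)) := by
      simp only [dotProduct, Matrix.mulVec_diagonal, Omega_mul_shiftL_sq_mulVec_y,
        Fin.sum_univ_four]
      rw [← hprod, ← hprod]
      simp [Fin.rev]
    rw [e, omega_mul_exp_add_conj, abs_of_nonneg (by linarith), ← Complex.ofReal_neg,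
      ← Complex.ofReal_mul]
    congr 1
    have ha : -(α / √2) * (x - ξ) = -(√2 / 2 * (α * (x - ξ))) := by rw [hs]; ring
    have hb : α / √2 * (x - ξ) = √2 / 2 * (α * (x - ξ)) := by rw [hs]; ring
    rw [ha, hb, omega_eq, Real.sin_add, Real.sin_pi_div_four, Real.cos_pi_div_four]
    simp [Complex.exp_re, Complex.exp_im]
    ring

theorem opK_matQ (l k : ℝ) {α : ℝ} (hα : 0 < α) : opK l α k (matQ α) = opInf l α k := by
  have h : green l α k (matQ α) = fun x ξ => (greenInf α k x ξ : ℂ) :=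
    funext₂ (green_matQ hα k)
  unfold opK opInf
  congr 1

theorem matQ_mem_wpR {l α : ℝ} (hl : 0 < l) (hα : α ≠ 0) : matQ α ∈ wpR l α :=
  ⟨isWellPosed_of_isUnit hl hα (isUnit_tilde_matQ l hα), fun i j => by
    rw [matQ, Matrix.map_apply, Complex.ofReal_im]⟩

/-! ### A real boundary condition with a prescribed eigenvalue -/

/-- The condition on `r.re` keeps `|e^{2lr}|` away from every `|e^{2l ω_j α}|`. For `κ ≥ 0` an
imaginary root is taken, since a real one fails at `κ = α⁴/4`. -/
theorem exists_pow_four_eq {α κ : ℝ} (hα : 0 < α) (hκ : κ ≠ -α ^ 4) :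
    ∃ r : ℂ, r ^ 4 = κ ∧ r.re ^ 2 ≠ α ^ 2 / 2 := by
  have root : ∀ t : ℝ, 0 ≤ t → √√t ^ 4 = t := by
    intro t ht
    calc √√t ^ 4 = (√√t ^ 2) ^ 2 := by ring
      _ = t := by rw [Real.sq_sqrt (Real.sqrt_nonneg _), Real.sq_sqrt ht]
  rcases le_or_gt 0 κ with h | h
  · refine ⟨Complex.I * √√κ, ?_, ?_⟩
    · rw [mul_pow, Complex.I_pow_four, one_mul, ← Complex.ofReal_pow, root κ h]
    · have : 0 < α ^ 2 / 2 := by positivity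
      simpa using this.ne
  · refine ⟨omega 0 * √√(-κ), ?_, ?_⟩
    · rw [mul_pow, omega_pow_four, ← Complex.ofReal_pow, root (-κ) (by linarith)]
      simp
    · rw [Complex.re_mul_ofReal, mul_pow, omega_re_sq]
      intro he
      have h2 : √√(-κ) ^ 2 = α ^ 2 := by linarith
      have h4 := root (-κ) (by linarith)
      apply hκ
      have : √√(-κ) ^ 4 = α ^ 4 := by
        calc √√(-κ) ^ 4 = (√√(-κ) ^ 2) ^ 2 := by ring
          _ = α ^ 4 := by rw [h2]; ring
      linarith

/-- The map taking the derivatives at `-l` of a solution of `u'''' + α⁴ u = 0` to those at `l`. -/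
noncomputable def transfer (l α : ℝ) : Matrix (Fin 4) (Fin 4) ℂ :=
  W α l * (W α (-l))⁻¹

theorem transfer_mul_W (l : ℝ) {α : ℝ} (hα : α ≠ 0) : transfer l α * W α (-l) = W α l := by
  rw [transfer, mul_assoc, Matrix.nonsing_inv_mul _ (W_det_isUnit hα _), mul_one]

theorem W_map_star (α x : ℝ) : (W α x).map star = (W α x).submatrix id Fin.revPerm := by
  ext i j
  have h : (starRingEnd ℂ) (omega j) = omega j.rev := star_omega j
  simp only [W, y, Matrix.map_apply, Matrix.of_apply, Matrix.submatrix_apply, id_eq,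
    Fin.revPerm_apply, Complex.star_def, map_mul, map_pow, ← Complex.exp_conj,
    Complex.conj_ofReal, h]

/-- Conjugation reverses the order of the columns of both Wronskian matrices, and this common
permutation cancels in `W(l) W(-l)⁻¹`. -/
theorem transfer_map_star (l : ℝ) {α : ℝ} (hα : α ≠ 0) :
    (transfer l α).map star = transfer l α := by
  have h : (transfer l α).map star * (W α (-l)).map star = (W α l).map star := by
    rw [← transfer_mul_W l hα]
    exact (Matrix.map_mul (f := starRingEnd ℂ)).symm
  have h' : (transfer l α).map star * W α (-l) = W α l := by
    ext i j
    have := congrFun (congrFun h i) j.rev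
    rw [W_map_star, W_map_star] at this
    simpa only [Matrix.mul_apply, Matrix.submatrix_apply, id, Fin.revPerm_apply, Fin.rev_rev]
      using this
  rw [← Matrix.mul_nonsing_inv_cancel_right (W α (-l)) ((transfer l α).map star)
    (W_det_isUnit hα _), h', transfer]

theorem exists_transfer_eq_map_ofReal (l : ℝ) {α : ℝ} (hα : α ≠ 0) :
    ∃ T : Matrix (Fin 4) (Fin 4) ℝ, transfer l α = T.map Complex.ofReal := by
  refine ⟨(transfer l α).map Complex.re, ?_⟩
  ext i j
  have := congrFun (congrFun (transfer_map_star l hα) i) j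
  simp only [Matrix.map_apply] at this ⊢
  exact (Complex.conj_eq_iff_re.1 this).symm

/-- In the coordinates `c`, `transfer` multiplies entry `j` by `e^{2l ω_j α}`, whereas the data of
`e^{rx}` at `l` are `e^{2lr}` times those at `-l`. Equality would force these factors to agree
wherever `c j ≠ 0`. -/
theorem transfer_mulVec_ne {l α : ℝ} (hl : 0 < l) (hα : α ≠ 0) {r : ℂ}
    (hr : r.re ^ 2 ≠ α ^ 2 / 2) :
    (transfer l α).mulVec (fun i : Fin 4 => r ^ (i : ℕ) * Complex.exp (r * (-l : ℝ))) ≠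
      fun i : Fin 4 => r ^ (i : ℕ) * Complex.exp (r * l) := by
  intro h
  set p : Fin 4 → ℂ := fun i => r ^ (i : ℕ) * Complex.exp (r * (-l : ℝ)) with hp
  set c := coeff α (-l) p with hc
  have hpc : (W α (-l)).mulVec c = p := W_mulVec_coeff hα _ _
  have hne : ∃ j, c j ≠ 0 := by
    by_contra! hall
    have h0 := congrFun hpc 0
    rw [show c = 0 from funext hall, Matrix.mulVec_zero] at h0
    simp [hp] at h0
    exact Complex.exp_ne_zero _ h0.symm
  obtain ⟨j, hj⟩ := hne
  set D : Fin 4 → ℂ := fun j => Complex.exp (2 * l * (omega j * α)) * c j with hD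
  have h1 : (W α l).mulVec c = (W α (-l)).mulVec D := by
    funext i
    simp only [Matrix.mulVec, dotProduct, W, Matrix.of_apply, hD, y]
    refine Finset.sum_congr rfl fun j _ => ?_
    have he : Complex.exp (omega j * α * l) =
        Complex.exp (omega j * α * (-l : ℝ)) * Complex.exp (2 * l * (omega j * α)) := by
      rw [← Complex.exp_add]
      congr 1
      push_cast
      ring
    rw [he]
    ring
  have h2 : (W α (-l)).mulVec D = (W α (-l)).mulVec (Complex.exp (2 * l * r) • c) := by
    rw [← h1, Matrix.mulVec_smul, hpc, ← transfer_mul_W l hα, ← Matrix.mulVec_mulVec, hpc, h]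
    funext i
    simp only [hp, Pi.smul_apply, smul_eq_mul]
    rw [mul_left_comm, ← Complex.exp_add]
    congr 2
    push_cast
    ring
  have h3 : D = Complex.exp (2 * l * r) • c := by
    rw [← coeff_W_mulVec hα (-l) D, h2, coeff_W_mulVec hα]
  have h4 : Complex.exp (2 * l * (omega j * α)) = Complex.exp (2 * l * r) :=
    mul_right_cancel₀ hj (congrFun h3 j)
  -- Exponents are determined only modulo `2πi`, so moduli are compared; hence the hypothesis on
  -- `r.re` alone.
  have h5 := congrArg norm h4
  rw [Complex.norm_exp, Complex.norm_exp, Real.exp_eq_exp] at h5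
  have h6 : (omega j).re * α = r.re := by
    have : 2 * l * ((omega j).re * α) = 2 * l * r.re := by simpa using h5
    exact mul_left_cancel₀ (by positivity) this
  apply hr
  rw [← h6, mul_pow, omega_re_sq]
  ring

theorem exists_real_solution {α l κ : ℝ} (hl : 0 < l) (hα : 0 < α) (hκ : κ ≠ -α ^ 4) :
    ∃ U : ℝ → Fin 4 → ℝ,
      (∀ x, HasDerivAt (fun x => U x 0) (U x 1) x) ∧
      (∀ x, HasDerivAt (fun x => U x 1) (U x 2) x) ∧
      (∀ x, HasDerivAt (fun x => U x 2) (U x 3) x) ∧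
      (∀ x, HasDerivAt (fun x => U x 3) (κ * U x 0) x) ∧
      (transfer l α).mulVec (fun i => (U (-l) i : ℂ)) ≠ fun i => (U l i : ℂ) := by
  obtain ⟨r, hr4, hr⟩ := exists_pow_four_eq hα hκ
  obtain ⟨T, hT⟩ := exists_transfer_eq_map_ofReal l hα.ne'
  obtain ⟨i, hi⟩ := Function.ne_iff.1 (transfer_mulVec_ne hl hα.ne' hr)
  set V : ℝ → Fin 4 → ℂ := fun x i => r ^ (i : ℕ) * Complex.exp (r * x) with hV
  set d : ℂ := V l i - (transfer l α).mulVec (V (-l)) i with hd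
  have hd0 : d ≠ 0 := sub_ne_zero.2 (Ne.symm hi)
  -- Since `transfer` is real, the `i`-th defect of the real part of `c V` is `Re (c d)`. This
  -- multiplier makes it `|d|²`, which is nonzero.
  set c := (starRingEnd ℂ) d with hc
  have hderiv : ∀ (n : ℕ) (x : ℝ), HasDerivAt
      (fun x : ℝ => (c * (r ^ n * Complex.exp (r * x))).re)
      (c * (r ^ (n + 1) * Complex.exp (r * x))).re x := by
    intro n x
    have h : HasDerivAt (fun x : ℝ => r * (x : ℂ)) r x := by
      simpa using (Complex.ofRealCLM.hasDerivAt (x := x)).const_mul r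
    have h' := ((h.cexp.const_mul (r ^ n)).const_mul c)
    have := Complex.reCLM.hasFDerivAt.comp_hasDerivAt x h'
    refine this.congr_deriv ?_
    simp only [Complex.reCLM_apply]
    congr 1
    ring
  refine ⟨fun x i => (c * V x i).re, hderiv 0, hderiv 1, hderiv 2, fun x => ?_, fun h => ?_⟩
  · refine (hderiv 3 x).congr_deriv ?_
    simp only [hV, Fin.val_zero, pow_zero, one_mul, hr4, ← Complex.re_ofReal_mul]
    congr 1
    ring
  · have h1 := congrFun h i
    have h2 : (transfer l α).mulVec (fun i => ((c * V (-l) i).re : ℂ)) i =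
        (((c * (transfer l α).mulVec (V (-l)) i).re : ℝ) : ℂ) := by
      simp only [hT, Matrix.mulVec, dotProduct, Matrix.map_apply, Finset.mul_sum]
      rw [Complex.re_sum, Complex.ofReal_sum]
      refine Finset.sum_congr rfl fun j _ => ?_
      rw [← Complex.ofReal_mul, mul_left_comm c (T i j : ℂ) (V (-l) j), Complex.re_ofReal_mul]
    rw [h2, Complex.ofReal_inj] at h1
    have h3 : (c * d).re = 0 := by
      rw [hd, mul_sub, Complex.sub_re, h1, sub_self]
    rw [hc, mul_comm, Complex.mul_conj, Complex.ofReal_re] at h3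
    exact hd0 (Complex.normSq_eq_zero.1 h3)

/-- A vector of boundary data outside the graph of `transfer` is annihilated by a real matrix
for which `tilde` is invertible. -/
theorem exists_boundary_condition (l : ℝ) {α : ℝ} (hα : α ≠ 0) {p q : Fin 4 → ℝ}
    (hpq : (transfer l α).mulVec (fun i => (p i : ℂ)) ≠ fun i => (q i : ℂ)) :
    ∃ M : Matrix (Fin 4) (Fin 8) ℂ, (∀ i j, (M i j).im = 0) ∧ IsUnit (tilde l α M).det ∧
      M.mulVec (Fin.append (m := 4) (n := 4) (fun i => (p i : ℂ)) fun i => (q i : ℂ)) = 0 := by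
  obtain ⟨T, hT⟩ := exists_transfer_eq_map_ofReal l hα
  have hmv : ∀ (A : Matrix (Fin 4) (Fin 4) ℝ) (v : Fin 4 → ℝ),
      (A.map Complex.ofReal).mulVec (fun i => (v i : ℂ)) =
        fun i => ((A.mulVec v i : ℝ) : ℂ) := by
    intro A v
    funext i
    simp [Matrix.mulVec, dotProduct]
  have hne : T.mulVec p ≠ q := by
    rintro rfl
    exact hpq (by rw [hT, hmv])
  obtain ⟨i, hi⟩ := Function.ne_iff.1 hne
  have hi' : (q - T.mulVec p) i ≠ 0 := sub_ne_zero.2 (Ne.symm hi)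
  -- A rank-one `P` sending `q - T p` to `-p`. With `N = 1 - P T`, `N p + P q = p + P (q - T p) =
  -- 0`, while `tilde` becomes `(N + P T) W(-l) = W(-l)`.
  set P : Matrix (Fin 4) (Fin 4) ℝ :=
    -Matrix.vecMulVec p (Pi.single i ((q - T.mulVec p) i)⁻¹) with hP
  set N : Matrix (Fin 4) (Fin 4) ℝ := 1 - P * T with hN
  have hPd : P.mulVec (q - T.mulVec p) = -p := by
    rw [hP, Matrix.neg_mulVec, Matrix.vecMulVec_mulVec, single_dotProduct, inv_mul_cancel₀ hi']
    simp
  have hzero : N.mulVec p + P.mulVec q = 0 := by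
    rw [Matrix.mulVec_sub] at hPd
    rw [hN, Matrix.sub_mulVec, Matrix.one_mulVec, ← Matrix.mulVec_mulVec]
    linear_combination hPd
  set M : Matrix (Fin 4) (Fin 8) ℂ :=
    Matrix.of fun a => Fin.append (m := 4) (n := 4) (N.map Complex.ofReal a)
      (P.map Complex.ofReal a) with hM
  have hMm : M.submatrix id (Fin.castAdd 4) = N.map Complex.ofReal := by
    ext a b
    exact Fin.append_left _ _ b
  have hMp : M.submatrix id (Fin.natAdd 4) = P.map Complex.ofReal := by
    ext a b
    exact Fin.append_right _ _ b
  refine ⟨M, fun a b => ?_, ?_, ?_⟩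
  · refine Fin.addCases (m := 4) (n := 4) (motive := fun b => (M a b).im = 0) (fun b => ?_)
      (fun b => ?_) b
    · rw [show M a (Fin.castAdd 4 b) = (N a b : ℂ) from congrFun (congrFun hMm a) b,
        Complex.ofReal_im]
    · rw [show M a (Fin.natAdd 4 b) = (P a b : ℂ) from congrFun (congrFun hMp a) b,
        Complex.ofReal_im]
  · have e : N.map Complex.ofReal = 1 - P.map Complex.ofReal * T.map Complex.ofReal := by
      change Complex.ofRealHom.mapMatrix N = _
      rw [hN, map_sub, map_one, map_mul]
      rfl
    have : tilde l α M = W α (-l) := by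
      rw [tilde, tildeMinus, tildePlus, hMm, hMp, e, sub_mul, one_mul, mul_assoc, ← hT,
        transfer_mul_W l hα, sub_add_cancel]
    rw [this]
    exact W_det_isUnit hα _
  · rw [mulVec_append, hMm, hMp, hmv, hmv]
    funext a
    have := congrFun hzero a
    simp only [Pi.add_apply, Pi.zero_apply] at this ⊢
    exact_mod_cast this

theorem exists_mem_wpR_mem_Spec {l α k : ℝ} (hl : 0 < l) (hα : 0 < α) (hk : 0 < k) {lam : ℝ}
    (hlam : lam ≠ 0) : ∃ M ∈ wpR l α, (lam : ℂ) ∈ Spec (opK l α k M) := by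
  have hne : α ^ 4 / (k * lam) ≠ 0 := by positivity
  -- This `κ` makes `u'''' + α⁴ u = (α⁴/k) (u / lam)`, which is the eigenvalue equation in
  -- differential form.
  obtain ⟨U, h0, h1, h2, h3, hU⟩ := exists_real_solution (κ := α ^ 4 / (k * lam) - α ^ 4) hl hα
    (fun h => hne (by linarith))
  obtain ⟨M, hMr, hMu, hMB⟩ := exists_boundary_condition l hα.ne' hU
  refine ⟨M, ⟨isWellPosed_of_isUnit hl hα.ne' hMu, hMr⟩, ?_⟩
  set u : ℝ → ℂ := fun x => (U x 0 : ℂ) with hu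
  have hU0 : Continuous fun x => U x 0 := continuous_iff_continuousAt.2 fun x => (h0 x).continuousAt
  have huc : Continuous u := Complex.continuous_ofReal.comp hU0
  have hint : ∀ x ∈ Icc (-l) l, ∫ ξ in Icc (-l) l, green l α k M x ξ * u ξ = lam * u x := by
    intro x hx
    have key := setIntegral_green_mul (k := k) hα.ne' hMu (U := fun x i => (U x i : ℂ))
      (f := fun x => ((α ^ 4 / (k * lam) : ℝ) : ℂ) * u x) (continuous_const.mul huc)
      (fun x => (h0 x).ofReal_comp) (fun x => (h1 x).ofReal_comp) (fun x => (h2 x).ofReal_comp)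
      (fun x => (h3 x).ofReal_comp.congr_deriv (by simp only [hu]; push_cast; ring)) hMB hx
    simp only [mul_left_comm _ ((α ^ 4 / (k * lam) : ℝ) : ℂ)] at key
    rw [integral_const_mul] at key
    have hc : ((α ^ 4 / (k * lam) : ℝ) : ℂ) ≠ 0 := Complex.ofReal_ne_zero.2 hne
    apply mul_left_cancel₀ hc
    rw [key]
    have hk' : (k : ℂ) ≠ 0 := Complex.ofReal_ne_zero.2 hk.ne'
    have hl' : (lam : ℂ) ≠ 0 := Complex.ofReal_ne_zero.2 hlam
    push_cast
    field_simp
    rfl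
  have hmem : MemLp u 2 ((volume : Measure ℝ).restrict (Icc (-l) l)) := by
    obtain ⟨C, hC⟩ := (isCompact_Icc (a := -l) (b := l)).exists_bound_of_continuousOn
      huc.continuousOn
    refine MemLp.of_bound huc.aestronglyMeasurable C ?_
    filter_upwards [ae_restrict_mem measurableSet_Icc] with x hx using hC x hx
  refine Module.End.hasEigenvalue_of_hasEigenvector (x := hmem.toLp u)
    (Module.End.hasEigenvector_iff.2 ⟨Module.End.mem_eigenspace_iff.2 ?_, fun hz => hU ?_⟩)
  · refine Lp.ext ?_
    refine (kernelOperator_ae_eq l _ (measurable_green l α k M) (bounded_green l α k M) _).trans ?_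
    filter_upwards [ae_restrict_mem measurableSet_Icc, Lp.coeFn_smul (lam : ℂ) (hmem.toLp u),
      hmem.coeFn_toLp] with x hx hs hux
    rw [hs, Pi.smul_apply, hux, smul_eq_mul, ← hint x hx]
    refine integral_congr_ae ?_
    filter_upwards [hmem.coeFn_toLp] with ξ hξ
    rw [hξ]
  -- If `u` were zero in `L²`, continuity would make `u` and its first three derivatives vanish on
  -- the closed interval. Zero data lie on the graph of `transfer`, contradicting `hU`.
  · have hae : u =ᵐ[volume.restrict (Icc (-l) l)] (fun _ => (0 : ℂ)) := by
      have := Lp.eq_zero_iff_ae_eq_zero.1 hz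
      exact hmem.coeFn_toLp.symm.trans this
    have hlt : -l < l := by linarith
    have hz0 : ∀ x ∈ Ioo (-l) l, U x 0 = 0 := by
      have := Measure.eqOn_open_of_ae_eq
        (ae_restrict_of_ae_restrict_of_subset Ioo_subset_Icc_self hae) isOpen_Ioo huc.continuousOn
        continuousOn_const
      intro x hx
      exact Complex.ofReal_eq_zero.1 (this hx)
    have step : ∀ {g g' : ℝ → ℝ}, (∀ x, HasDerivAt g (g' x) x) → (∀ x ∈ Ioo (-l) l, g x = 0) →
        ∀ x ∈ Ioo (-l) l, g' x = 0 := by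
      intro g g' hg h x hx
      refine (hg x).unique ((hasDerivAt_const x (0 : ℝ)).congr_of_eventuallyEq ?_)
      filter_upwards [isOpen_Ioo.mem_nhds hx] with t ht using h t ht
    have hz1 := step h0 hz0
    have hz2 := step h1 hz1
    have hz3 := step h2 hz2
    have ends : ∀ {g g' : ℝ → ℝ}, (∀ x, HasDerivAt g (g' x) x) → (∀ x ∈ Ioo (-l) l, g x = 0) →
        ∀ x ∈ Icc (-l) l, g x = 0 := by
      intro g g' hg h x hx
      have hgc : Continuous g := continuous_iff_continuousAt.2 fun x => (hg x).continuousAt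
      have hcl : IsClosed {x | g x = 0} := isClosed_eq hgc continuous_const
      rw [← closure_Ioo hlt.ne] at hx
      exact closure_minimal (fun t ht => h t ht) hcl hx
    have hall : ∀ x ∈ Icc (-l) l, (fun i => (U x i : ℂ)) = 0 := by
      intro x hx
      funext i
      fin_cases i
      · exact Complex.ofReal_eq_zero.2 (ends h0 hz0 x hx)
      · exact Complex.ofReal_eq_zero.2 (ends h1 hz1 x hx)
      · exact Complex.ofReal_eq_zero.2 (ends h2 hz2 x hx)
      · exact Complex.ofReal_eq_zero.2 (ends h3 hz3 x hx)
    rw [hall (-l) ⟨le_rfl, hlt.le⟩, hall l ⟨hlt.le, le_rfl⟩, Matrix.mulVec_zero]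

theorem norm_le_opNorm_of_mem_Spec {l : ℝ} {K : L2 l →L[ℂ] L2 l} {μ : ℂ} (h : μ ∈ Spec K) :
    ‖μ‖ ≤ ‖K‖ := by
  obtain ⟨v, hv⟩ := Module.End.HasEigenvalue.exists_hasEigenvector h
  have h1 : K v = μ • v := hv.apply_eq_smul
  have h2 := K.le_opNorm v
  rw [h1, norm_smul] at h2
  exact le_of_mul_le_mul_right h2 (norm_pos_iff.2 hv.2)

end Beam

theorem theorem2 (l α k : ℝ) (hl : 0 < l) (hα : 0 < α) (hk : 0 < k) :
    (Beam.matQ α ∈ Beam.wpR l α ∧ Beam.opK l α k (Beam.matQ α) = Beam.opInf l α k) ∧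
    (∀ lam : ℝ, lam ≠ 0 → (lam : ℂ) ∉ Beam.Spec (Beam.opK l α k (Beam.matQ α)) →
      ∃ M ∈ Beam.wpR l α, (lam : ℂ) ∈ Beam.Spec (Beam.opK l α k M)) ∧
    (∃ M ∈ Beam.wpR l α,
      ¬ Beam.IsPos k (Beam.opK l α k M) ∧ ¬ Beam.IsContractive k (Beam.opK l α k M)) := by
  refine ⟨⟨Beam.matQ_mem_wpR hl hα.ne', Beam.opK_matQ l k hα⟩,
    fun lam hlam _ => Beam.exists_mem_wpR_mem_Spec hl hα hk hlam, ?_⟩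
  -- The eigenvalue `-1/k` has intrinsic value `-1`: it is not positive, and its modulus 1 bounds `k
  -- ‖K‖` from below.
  have hneg : -1 / k < 0 := div_neg_of_neg_of_pos (by norm_num) hk
  have hkk : k * (-1 / k) = -1 := by field_simp
  obtain ⟨M, hM, hspec⟩ := Beam.exists_mem_wpR_mem_Spec hl hα hk hneg.ne
  refine ⟨M, hM, fun hpos => ?_, fun hcon => ?_⟩
  · obtain ⟨r, hr, h⟩ := hpos _ hspec
    rw [← Complex.ofReal_mul, Complex.ofReal_inj, hkk] at h
    linarith
  · have h := Beam.norm_le_opNorm_of_mem_Spec hspec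
    rw [Complex.norm_real, Real.norm_of_nonpos hneg.le] at h
    have h2 := mul_le_mul_of_nonneg_left h hk.le
    have h3 : k * ‖Beam.opK l α k M‖ < 1 := hcon
    linarith
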